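/- For a word $w$ over a finite alphabet $\Sigma$ let $\tilde w=\text{¢}\,w\,\$$ denote $w$ enclosed between two end-markers, and let $\tilde\Sigma=\Sigma\cup\{\text{¢},\$\}$. A real-time probabilistic finite automaton (PFA) consists of a finite state set $Q$, an initial state $q_1\in Q$, a set $Q_a\subseteq Q$ of accept states, and for each $\sigma\in\tilde\Sigma$ a real $Q\times Q$ matrix $A_\sigma$ whose columns are stochastic vectors. It accepts $w$ with probability $\sum_{q\in Q_a}v[q]$, where $v=A_{\tilde w_{|\tilde w|}}\cdots A_{\tilde w_1}e_{q_1}$. The class $\mathsf{S}$ of stochastic languages consists of the languages $L\subseteq\Sigma^*$ ($\Sigma$ a finite alphabet) for which some PFA accepts $w$ with probability $>\frac12$ if and only if $w\in L$, for every $w\in\Sigma^*$. Let $\mathbb{K}$ be $\mathbb{R}$ or $\mathbb{C}$. A real-time quantum finite automaton with postselection (QFAP) with amplitudes in $\mathbb{K}$ consists of a finite state set $Q$ partitioned into $Q_{pa}$, $Q_{pr}$, $Q_{nh}$ (postselection accept, postselection reject, and nonpostselection halting states), an initial state $q_1\in Q$, and for each $\sigma\in\tilde\Sigma$ finitely many $Q\times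 Q$ matrices $E_{\sigma,1},\dots,E_{\sigma,k}$ over $\mathbb{K}$ with $\sum_i E_{\sigma,i}^\dagger E_{\sigma,i}=I$. On input $w$ its state evolves by $\rho_0=|q_1\rangle\langle q_1|$, $\rho_j=\sum_i E_{\tilde w_j,i}\,\rho_{j-1}E_{\tilde w_j,i}^\dagger$. Put $p^a(w)=\mathrm{tr}(P_{pa}\,\rho_{|\tilde w|})$ and $p^r(w)=\mathrm{tr}(P_{pr}\,\rho_{|\tilde w|})$, where $P_\tau=\sum_{q\in Q_\tau}|q\rangle\langle q|$; it is required that $p^a(w)+p^r(w)>0$ for every $w\in\Sigma^*$. The QFAP accepts $w$ with probability $\frac{p^a(w)}{p^a(w)+p^r(w)}$ and rejects $w$ with probability $\frac{p^r(w)}{p^a(w)+p^r(w)}$. The class $\mathsf{PostBQAL}$ consists of the languages $L\subseteq\Sigma^*$ ($\Sigma$ a finite alphabet) recognized with two-sided bounded error by some QFAP: there is $\epsilon$ with $0\le\epsilon<\frac12$ such that every $w\in L$ is accepted with probability at least $1-\epsilon$ and every $w\in\Sigma^*\setminus L$ is rejected with probability at least $1-\epsilon$. Theorem. $\mathsf{PostBQAL}\subsetneq\mathsf{S}$: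 every language in $\mathsf{PostBQAL}$ is stochastic, and some stochastic language (over some finite alphabet) is not in $\mathsf{PostBQAL}$. This holds both for $\mathbb{K}=\mathbb{R}$ and for $\mathbb{K}=\mathbb{C}$. -/

import Mathlib

open scoped Matrix

/-- A formal language over some finite alphabet. -/
structure FormalLanguage where
  /-- the input alphabet `Σ` -/
  alphabet : Type
  finite_alphabet : Finite alphabet
  /-- the set of words of the language, a subset of `Σ*` -/
  words : Language alphabet

/-- The tape alphabet: the input symbols together with the two end-markers. -/
inductive TapeSymbol (α : Type) where
  | leftEnd : TapeSymbol α
  | letter (a : α) : TapeSymbol α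
  | rightEnd : TapeSymbol α

/-- The string that a real-time machine reads on input `w`: `w` between the two end-markers. -/
def tape {α : Type} (w : List α) : List (TapeSymbol α) :=
  TapeSymbol.leftEnd :: (w.map TapeSymbol.letter ++ [TapeSymbol.rightEnd])

/-! ### Real-time probabilistic finite automata and stochastic languages -/

/-- A real-time probabilistic finite automaton with input alphabet `α` and state set `Q`. The
`(j, i)` entry of `trans σ` is the probability of moving from `i` to `j` on reading `σ`, so the
columns of `trans σ` are stochastic. States outside `accept` are reject states. -/
structure PFA (α Q : Type) [Fintype Q] [DecidableEq Q] where
  trans : TapeSymbol α → Matrix Q Q ℝ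
  trans_stochastic : ∀ σ, trans σ ∈ Matrix.colStochastic ℝ Q
  init : Q
  accept : Finset Q

namespace PFA

variable {α Q : Type} [Fintype Q] [DecidableEq Q]

/-- The state vector after reading the whole tape. -/
def finalVector (M : PFA α Q) (w : List α) : Q → ℝ :=
  (tape w).foldl (fun v σ => M.trans σ *ᵥ v) (Pi.single M.init 1)

/-- The probability that the automaton accepts `w`. -/
def acceptProb (M : PFA α Q) (w : List α) : ℝ :=
  ∑ q ∈ M.accept, M.finalVector w q

end PFA

/-- The class `S` of stochastic languages: those recognized with strict cutpoint `1/2` by a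
real-time probabilistic finite automaton. -/
def StochasticLanguages : Set FormalLanguage :=
  {L | ∃ (Q : Type) (_ : Fintype Q) (_ : DecidableEq Q) (M : PFA L.alphabet Q),
    ∀ w : List L.alphabet, w ∈ L.words ↔ 1 / 2 < M.acceptProb w}

/-! ### Real-time quantum finite automata with postselection -/

/-- The three types of states of an automaton with postselection: postselection accept,
postselection reject, and nonpostselection halting. -/
inductive PostOutcome where
  | pa : PostOutcome
  | pr : PostOutcome
  | nh : PostOutcome
  deriving DecidableEq

/-- The program of a real-time quantum finite automaton with amplitudes in `𝕜`, together with the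
partition of its states. On reading `σ` the superoperator with operation elements
`kraus σ 0, …, kraus σ (k σ - 1)` is applied. -/
structure QFAProgram (𝕜 : Type*) [RCLike 𝕜] (α Q : Type) [Fintype Q] [DecidableEq Q] where
  k : TapeSymbol α → ℕ
  kraus : (σ : TapeSymbol α) → Fin (k σ) → Matrix Q Q 𝕜
  kraus_complete : ∀ σ, ∑ i, (kraus σ i)ᴴ * kraus σ i = 1
  init : Q
  outcome : Q → PostOutcome

namespace QFAProgram

variable {𝕜 : Type*} [RCLike 𝕜] {α Q : Type} [Fintype Q] [DecidableEq Q]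

/-- The superoperator `ρ ↦ ∑ i, E_{σ,i} ρ E_{σ,i}†` applied on reading `σ`. -/
def superop (M : QFAProgram 𝕜 α Q) (σ : TapeSymbol α) (ρ : Matrix Q Q 𝕜) : Matrix Q Q 𝕜 :=
  ∑ i, M.kraus σ i * ρ * (M.kraus σ i)ᴴ

/-- The density matrix after reading the whole tape, starting from `|q₁⟩⟨q₁|`. -/
def finalState (M : QFAProgram 𝕜 α Q) (w : List α) : Matrix Q Q 𝕜 :=
  (tape w).foldl (fun ρ σ => M.superop σ ρ) (Matrix.single M.init M.init 1)

/-- The projection `∑_{q ∈ Q_τ} |q⟩⟨q|` onto the span of the states of type `τ`. -/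
def proj (M : QFAProgram 𝕜 α Q) (τ : PostOutcome) : Matrix Q Q 𝕜 :=
  Matrix.diagonal fun q => if M.outcome q = τ then 1 else 0

/-- The probability, before postselection, of observing a state of type `τ` at the end. The trace
is a nonnegative real number; `RCLike.re` only changes its type to `ℝ`. -/
noncomputable def outcomeProb (M : QFAProgram 𝕜 α Q) (τ : PostOutcome) (w : List α) : ℝ :=
  RCLike.re (M.proj τ * M.finalState w).trace

end QFAProgram

/-- A real-time quantum finite automaton with postselection: every input leads to a postselection
state with nonzero probability. -/
structure QFAP (𝕜 : Type*) [RCLike 𝕜] (α Q : Type) [Fintype Q] [DecidableEq Q]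
    extends QFAProgram 𝕜 α Q where
  postselection_pos : ∀ w : List α,
    0 < toQFAProgram.outcomeProb PostOutcome.pa w + toQFAProgram.outcomeProb PostOutcome.pr w

namespace QFAP

variable {𝕜 : Type*} [RCLike 𝕜] {α Q : Type} [Fintype Q] [DecidableEq Q]

/-- The probability that `w` is accepted, after postselection. -/
noncomputable def acceptProb (M : QFAP 𝕜 α Q) (w : List α) : ℝ :=
  M.outcomeProb PostOutcome.pa w /
    (M.outcomeProb PostOutcome.pa w + M.outcomeProb PostOutcome.pr w)

/-- The probability that `w` is rejected, after postselection. -/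
noncomputable def rejectProb (M : QFAP 𝕜 α Q) (w : List α) : ℝ :=
  M.outcomeProb PostOutcome.pr w /
    (M.outcomeProb PostOutcome.pa w + M.outcomeProb PostOutcome.pr w)

/-- Recognition of a language with two-sided bounded error. -/
def RecognizesBoundedError (M : QFAP 𝕜 α Q) (L : Language α) : Prop :=
  ∃ ε : ℝ, 0 ≤ ε ∧ ε < 1 / 2 ∧
    (∀ w : List α, w ∈ L → 1 - ε ≤ M.acceptProb w) ∧
    (∀ w : List α, w ∉ L → 1 - ε ≤ M.rejectProb w)

end QFAP

/-- The class `PostBQAL` of languages recognized with two-sided bounded error by real-time quantum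
finite automata with postselection, with amplitudes in `𝕜`. -/
def PostBQAL (𝕜 : Type*) [RCLike 𝕜] : Set FormalLanguage :=
  {L | ∃ (Q : Type) (_ : Fintype Q) (_ : DecidableEq Q) (M : QFAP 𝕜 L.alphabet Q),
    M.RecognizesBoundedError L.words}

/-! Inclusion. The density matrix of a QFAP lives in a finite-dimensional real vector space, evolves
by linear maps, and `p^a - p^r` is a linear functional of it; with bounded error its sign decides
membership. By Turakainen's argument (`mem_stochasticLanguages_of_linear`) the sign of a functional
of a linear automaton can be read off a PFA with cutpoint 1/2: take coordinates, rescale the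
matrices, and represent signed vectors by two copies of each state.

Strictness. The witness is the unary language of the `n` with `cos (2πnθ) > 0`, `θ = √2`. It is
stochastic because a plane rotation is linear. If a QFAP with error `ε` recognized it, then `s = p^a
+ p^r` and `t = p^a - p^r` on the words `a^n` would satisfy one linear recurrence (Cayley–Hamilton),
with `0 < s ≤ 1`, `|t| ≤ s`, and `κ s ≤ t` or `κ s ≤ -t` according to the sign of the cosine, where
`κ = 1 - 2ε > 0`.

Let `ρ` be the radius of convergence of `∑ s_n τ^n`. For suitable `τ → ρ` there are starting points
from which the tails decay slowly (`exists_slow_tail`). Put the weights `s_n τ^n` and `t_n τ^n` of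
such a tail at the points `nθ` of the circle, normalize by the mass of `s`, and pass to weak-*
limits `S`, `T`. Slow decay makes shifts of the index negligible, so the recurrence with
characteristic polynomial `c` becomes `c(1/(ρ e^{2πilθ})) S(e_l) = 0`, and likewise for `T`
(`exists_asymptotic_functionals`). As `θ` is irrational, only finitely many `l` survive, so on real
functions the real parts of `S` and `T` are given by real trigonometric polynomials `σ` and `ζ`.

The inequalities pass to the limit: `|ζ| ≤ σ`, with `κσ ≤ ζ` where the cosine is positive and `κσ ≤
-ζ` where it is negative. At a zero of the cosine the bounded quotient `ζ/σ` of analytic functions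
has only one limit, so it cannot jump from at least `κ` to at most `-κ`
(`eventually_eq_zero_of_sign_change`). Hence `σ` vanishes near that point, so identically, against
`S(1) = 1`. -/

/-! ### Real-linear automata define stochastic languages -/

section SignedLift

variable {J : Type} [Fintype J] [DecidableEq J]

/-- The stochastic matrix on signed copies of `J` that simulates `C`: the entries of `C` are split
into positive and negative parts, and the missing probability of each column goes in equal parts to
the two copies of `j₀`. -/
noncomputable def signedLift (C : Matrix J J ℝ) (j₀ : J) : Matrix (J × Bool) (J × Bool) ℝ :=
  fun x y => (if x.2 = y.2 then max (C x.1 y.1) 0 else max (-C x.1 y.1) 0) +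
    if x.1 = j₀ then (1 - ∑ k, |C k y.1|) / 2 else 0

/-- The signed vector represented by a vector on the signed copies of `J`. -/
def signedDiff (v : J × Bool → ℝ) : J → ℝ := fun j => v (j, true) - v (j, false)

theorem max_zero_sub_max_neg_zero (a : ℝ) : max a 0 - max (-a) 0 = a := by
  rcases le_total a 0 with h | h
  · rw [max_eq_right h, max_eq_left (by linarith)]; ring
  · rw [max_eq_left h, max_eq_right (by linarith)]; ring

theorem max_zero_add_max_neg_zero (a : ℝ) : max a 0 + max (-a) 0 = |a| := by
  rcases le_total a 0 with h | h
  · rw [max_eq_right h, max_eq_left (by linarith), abs_of_nonpos h]; ring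
  · rw [max_eq_left h, max_eq_right (by linarith), abs_of_nonneg h]; ring

theorem signedLift_mem_colStochastic {C : Matrix J J ℝ} (hC : ∀ i, ∑ k, |C k i| ≤ 1) (j₀ : J) :
    signedLift C j₀ ∈ Matrix.colStochastic ℝ (J × Bool) := by
  rw [Matrix.mem_colStochastic_iff_sum]
  refine ⟨fun x y => ?_, fun y => ?_⟩
  · have := hC y.1
    unfold signedLift
    refine add_nonneg ?_ ?_ <;> split_ifs <;> positivity
  · obtain ⟨i, t⟩ := y
    have h : ∀ j, signedLift C j₀ (j, true) (i, t) + signedLift C j₀ (j, false) (i, t) =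
        |C j i| + if j = j₀ then 1 - ∑ k, |C k i| else 0 := by
      intro j
      have := max_zero_add_max_neg_zero (C j i)
      rcases eq_or_ne j j₀ with rfl | hj
      · cases t <;> (simp [signedLift]; linarith)
      · cases t <;> simp [signedLift, hj] <;> linarith
    rw [Fintype.sum_prod_type]
    simp only [Fintype.sum_bool, h, Finset.sum_add_distrib, Finset.sum_ite_eq', Finset.mem_univ,
      if_true]
    ring

/-- A negative entry moves mass to the copy of opposite sign, and the missing probability reaches
both copies of `j₀` equally, so it cancels in the difference. -/
theorem signedDiff_signedLift_mulVec (C : Matrix J J ℝ) (j₀ : J) (v : J × Bool → ℝ) :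
    signedDiff (signedLift C j₀ *ᵥ v) = C *ᵥ signedDiff v := by
  funext j
  simp only [signedDiff, Matrix.mulVec, dotProduct, Fintype.sum_prod_type, Fintype.sum_bool,
    ← Finset.sum_sub_distrib]
  refine Finset.sum_congr rfl fun i _ => ?_
  have := max_zero_sub_max_neg_zero (C j i)
  simp only [signedLift, if_true, Bool.true_eq_false, Bool.false_eq_true, if_false]
  linear_combination (v (i, true) - v (i, false)) * this

end SignedLift

theorem sum_foldl_mulVec {S J : Type} [Fintype J] [DecidableEq J] (A : S → Matrix J J ℝ)
    (hA : ∀ σ, A σ ∈ Matrix.colStochastic ℝ J) (l : List S) (v : J → ℝ) :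
    ∑ j, l.foldl (fun v σ => A σ *ᵥ v) v j = ∑ j, v j := by
  induction l generalizing v with
  | nil => rfl
  | cons σ l ih =>
    rw [List.foldl_cons, ih]
    simp only [Matrix.mulVec, dotProduct]
    rw [Finset.sum_comm]
    refine Finset.sum_congr rfl fun i _ => ?_
    rw [← Finset.sum_mul, (Matrix.mem_colStochastic_iff_sum.1 (hA σ)).2 i, one_mul]

theorem signedDiff_foldl {S J : Type} [Fintype J] [DecidableEq J] (C : S → Matrix J J ℝ) (j₀ : J)
    (l : List S) (v : J × Bool → ℝ) :
    signedDiff (l.foldl (fun v σ => signedLift (C σ) j₀ *ᵥ v) v) =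
      l.foldl (fun v σ => C σ *ᵥ v) (signedDiff v) := by
  induction l generalizing v with
  | nil => rfl
  | cons σ l ih => rw [List.foldl_cons, List.foldl_cons, ih, signedDiff_signedLift_mulVec]

theorem exists_pos_foldl_smul {S V : Type*} [AddCommGroup V] [Module ℝ V] (f : S → V →ₗ[ℝ] V)
    (c : S → ℝ) (hc : ∀ σ, 0 < c σ) (l : List S) (v : V) :
    ∃ a : ℝ, 0 < a ∧ l.foldl (fun v σ => c σ • f σ v) v = a • l.foldl (fun v σ => f σ v) v := by
  induction l using List.reverseRecOn with
  | nil => exact ⟨1, one_pos, by simp⟩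
  | append_singleton l σ ih =>
    obtain ⟨a, ha, h⟩ := ih
    refine ⟨c σ * a, mul_pos (hc σ) ha, ?_⟩
    simp only [List.foldl_append, List.foldl_cons, List.foldl_nil, h, map_smul, smul_smul]

theorem mem_stochasticLanguages_of_matrix {L : FormalLanguage} {J : Type} [Fintype J]
    [DecidableEq J] (B : TapeSymbol L.alphabet → Matrix J J ℝ) (j₀ : J)
    (h : ∀ w, w ∈ L.words ↔
      0 < ∑ j, (tape w).foldl (fun v σ => B σ *ᵥ v) (Pi.single j₀ 1) j) :
    L ∈ StochasticLanguages := by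
  -- The factor makes every absolute column sum at most 1; the summand 1 avoids division by zero.
  -- Positive factors do not affect the sign tested at the end.
  set c : TapeSymbol L.alphabet → ℝ := fun σ => (1 + ∑ i, ∑ k, |B σ k i|)⁻¹ with hc
  have hS : ∀ σ, 0 ≤ ∑ i, ∑ k, |B σ k i| := fun σ =>
    Finset.sum_nonneg fun i _ => Finset.sum_nonneg fun k _ => abs_nonneg _
  have hcpos : ∀ σ, 0 < c σ := fun σ => inv_pos.2 (by linarith [hS σ])
  have hcol : ∀ σ i, ∑ k, |(c σ • B σ) k i| ≤ 1 := by
    intro σ i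
    simp only [Matrix.smul_apply, smul_eq_mul, abs_mul, abs_of_pos (hcpos σ), ← Finset.mul_sum]
    rw [hc]
    simp only
    rw [inv_mul_le_iff₀ (by linarith [hS σ]), mul_one]
    have : ∑ k, |B σ k i| ≤ ∑ i, ∑ k, |B σ k i| :=
      Finset.single_le_sum (f := fun i => ∑ k, |B σ k i|)
        (fun i _ => Finset.sum_nonneg fun k _ => abs_nonneg _) (Finset.mem_univ i)
    linarith
  let M : PFA L.alphabet (J × Bool) :=
    { trans := fun σ => signedLift (c σ • B σ) j₀
      trans_stochastic := fun σ => signedLift_mem_colStochastic (hcol σ) j₀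
      init := (j₀, true)
      accept := Finset.univ.filter fun x => x.2 = true }
  refine ⟨J × Bool, inferInstance, inferInstance, M, fun w => ?_⟩
  have htot : ∑ x, M.finalVector w x = 1 := by
    refine (sum_foldl_mulVec _ M.trans_stochastic _ _).trans ?_
    simp
  have hdiff : signedDiff (M.finalVector w) =
      (tape w).foldl (fun v σ => c σ • (B σ).mulVecLin v) (Pi.single j₀ 1) := by
    refine (signedDiff_foldl (fun σ => c σ • B σ) j₀ _ _).trans ?_
    have : signedDiff (Pi.single (j₀, true) (1 : ℝ)) = Pi.single j₀ 1 := by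
      funext j
      by_cases hj : j = j₀ <;> simp [signedDiff, hj]
    simp [M, this, Matrix.smul_mulVec]
  obtain ⟨a, ha, hfold⟩ := exists_pos_foldl_smul (fun σ => (B σ).mulVecLin) c hcpos (tape w)
    (Pi.single j₀ 1)
  rw [hfold] at hdiff
  have hsum : ∑ j, signedDiff (M.finalVector w) j =
      a * ∑ j, (tape w).foldl (fun v σ => B σ *ᵥ v) (Pi.single j₀ 1) j := by
    rw [hdiff, Finset.mul_sum]
    rfl
  have hacc : M.acceptProb w = ∑ j, M.finalVector w (j, true) := by
    simp [PFA.acceptProb, M, Finset.sum_filter, Fintype.sum_prod_type]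
  rw [Fintype.sum_prod_type] at htot
  simp only [Fintype.sum_bool, Finset.sum_add_distrib] at htot
  simp only [signedDiff, Finset.sum_sub_distrib] at hsum
  -- The masses of the two signed copies add up to 1 and differ by a positive multiple of the tested
  -- sum, so acceptance exceeds 1/2 exactly when that sum is positive.
  rw [h w, hacc, ← mul_pos_iff_of_pos_left ha, ← hsum]
  constructor <;> intro h <;> linarith

/-- A language defined by the sign of a linear functional of the state of a finite-dimensional
real-linear automaton is stochastic. -/
theorem mem_stochasticLanguages_of_linear {L : FormalLanguage} {E : Type*} [AddCommGroup E]
    [Module ℝ E] [FiniteDimensional ℝ E] [Nontrivial E]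
    (T : TapeSymbol L.alphabet → E →ₗ[ℝ] E) (v₀ : E) (φ : E →ₗ[ℝ] ℝ)
    (h : ∀ w, w ∈ L.words ↔ 0 < φ ((tape w).foldl (fun v σ => T σ v) v₀)) :
    L ∈ StochasticLanguages := by
  classical
  let b := Module.finBasis ℝ E
  obtain ⟨j₀⟩ : Nonempty (Fin (Module.finrank ℝ E)) := ⟨⟨0, Module.finrank_pos⟩⟩
  -- The end-markers absorb the boundary data: the left one sends a basis vector to `T .leftEnd v₀`,
  -- the right one writes the value of `φ` into a single coordinate, so that the sum of all
  -- coordinates is that value.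
  let T' : TapeSymbol L.alphabet → E →ₗ[ℝ] E := fun σ =>
    match σ with
    | .leftEnd => (b.coord j₀).smulRight (T .leftEnd v₀)
    | .letter a => T (.letter a)
    | .rightEnd => (φ ∘ₗ T .rightEnd).smulRight (b j₀)
  refine mem_stochasticLanguages_of_matrix (fun σ => LinearMap.toMatrix b b (T' σ)) j₀ fun w => ?_
  have key : ∀ (l : List (TapeSymbol L.alphabet)) (v : E),
      l.foldl (fun v σ => LinearMap.toMatrix b b (T' σ) *ᵥ v) (b.repr v) =
        b.repr (l.foldl (fun v σ => T' σ v) v) := by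
    intro l
    induction l with
    | nil => intro v; rfl
    | cons σ l ih =>
      intro v
      rw [List.foldl_cons, List.foldl_cons, LinearMap.toMatrix_mulVec_repr, ih]
  have hj : (Pi.single j₀ 1 : Fin (Module.finrank ℝ E) → ℝ) = b.repr (b j₀) := by
    rw [Module.Basis.repr_self, Finsupp.single_eq_pi_single]
  have hl : ∀ (w : List L.alphabet) (v : E),
      (w.map TapeSymbol.letter).foldl (fun v σ => T' σ v) v =
        (w.map TapeSymbol.letter).foldl (fun v σ => T σ v) v := by
    intro w
    induction w with
    | nil => intro v; rfl
    | cons a w ih => intro v; exact ih _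
  rw [hj, key, h w]
  simp [tape, List.foldl_append, hl, T', Finsupp.single_apply]

open Filter Topology

/-! ### Linear recurrences and their tails -/

theorem summable_nat_add_of {E : Type*} [NormedAddCommGroup E] {a : ℕ → E} (ha : Summable a)
    (N : ℕ) : Summable fun n => a (n + N) :=
  (summable_nat_add_iff N).2 ha

/-- The tails of a summable geometric reweighting of a linear recurrence satisfy a linear relation. -/
theorem sum_coeff_mul_tail_eq_zero {𝕜 : Type*} [RCLike 𝕜] (c x : ℕ → 𝕜) (d : ℕ)
    (hrec : ∀ n, ∑ j ∈ Finset.range d, c j * x (n + j) = 0) {w : 𝕜} (hw : w ≠ 0)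
    (hs : Summable fun n => x n * w ^ n) (N : ℕ) :
    ∑ j ∈ Finset.range d, c j * (w⁻¹) ^ j * ∑' n, x (n + (N + j)) * w ^ (n + (N + j)) = 0 := by
  have hsum : ∀ M, Summable fun n => x (n + M) * w ^ (n + M) :=
    fun M => summable_nat_add_of (a := fun n => x n * w ^ n) hs M
  simp only [← tsum_mul_left]
  rw [← Summable.tsum_finsetSum fun j _ => (hsum (N + j)).mul_left _]
  convert tsum_zero with n
  have := hrec (n + N)
  have h2 : ∀ j ∈ Finset.range d, c j * (w⁻¹) ^ j * (x (n + (N + j)) * w ^ (n + (N + j))) =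
      w ^ (n + N) * (c j * x (n + N + j)) := by
    intro j _
    rw [← add_assoc, pow_add w (n + N) j, inv_pow]
    field_simp
  rw [Finset.sum_congr rfl h2, ← Finset.mul_sum, this, mul_zero]

theorem tail_add_le {a : ℕ → ℝ} (h0 : ∀ n, 0 ≤ a n) (ha : Summable a) {M N : ℕ} (h : M ≤ N) :
    ∑' n, a (n + N) ≤ ∑' n, a (n + M) := by
  obtain ⟨k, rfl⟩ := Nat.exists_eq_add_of_le h
  have := (summable_nat_add_of ha M).sum_add_tsum_nat_add k
  have h2 : 0 ≤ ∑ i ∈ Finset.range k, a (i + M) := Finset.sum_nonneg fun i _ => h0 _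
  have h3 : ∀ n, n + k + M = n + (M + k) := fun n => by omega
  simp only [h3] at this
  linarith

theorem norm_tail_sub_tail_le {b : ℕ → ℂ} {a : ℕ → ℝ} (hb : ∀ n, ‖b n‖ ≤ a n) (ha : Summable a)
    (N j : ℕ) :
    ‖∑' n, b (n + N) - ∑' n, b (n + (N + j))‖ ≤ ∑' n, a (n + N) - ∑' n, a (n + (N + j)) := by
  have hbs : Summable b := Summable.of_norm_bounded ha hb
  have h1 := (summable_nat_add_of ha N).sum_add_tsum_nat_add j
  have h2 := (summable_nat_add_of hbs N).sum_add_tsum_nat_add j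
  have h3 : ∀ n, n + j + N = n + (N + j) := fun n => by omega
  simp only [h3] at h1 h2
  rw [← h1, ← h2, add_sub_cancel_right, add_sub_cancel_right]
  exact norm_sum_le_of_le _ fun i _ => hb _

/-- A positive solution of a recurrence cannot decay superexponentially. In the relation between
tails, every term after the lowest nonzero coefficient carries an extra factor `τ⁻¹` and a smaller
tail, so a large `τ` would leave the lowest term unbalanced. -/
theorem bddAbove_summable_of_recurrence {s : ℕ → ℝ} (hpos : ∀ n, 0 < s n) {c : Polynomial ℝ}
    (hc : c ≠ 0)
    (hrec : ∀ n, ∑ j ∈ Finset.range (c.natDegree + 1), c.coeff j * s (n + j) = 0) :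
    BddAbove {τ : ℝ | 0 < τ ∧ Summable fun n => s n * τ ^ n} := by
  set a := c.natTrailingDegree
  have hca : c.coeff a ≠ 0 := Polynomial.coeff_natTrailingDegree_ne_zero.2 hc
  set S := ∑ j ∈ Finset.range (c.natDegree + 1), |c.coeff j|
  refine ⟨max 1 (S / |c.coeff a|), fun τ ⟨hτ, hs⟩ => ?_⟩
  rcases le_total τ 1 with h1 | h1
  · exact h1.trans (le_max_left _ _)
  refine le_max_of_le_right ?_
  rw [le_div_iff₀ (abs_pos.2 hca)]
  have hterm : ∀ n, 0 < s n * τ ^ n := fun n => mul_pos (hpos n) (pow_pos hτ n)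
  have hrel := sum_coeff_mul_tail_eq_zero c.coeff s _ hrec hτ.ne' hs 0
  simp only [zero_add] at hrel
  set G : ℕ → ℝ := fun j => ∑' n, s (n + j) * τ ^ (n + j) with hG
  have hG0 : ∀ j, 0 < G j := fun j =>
    (summable_nat_add_of hs j).tsum_pos (fun n => (hterm _).le) 0 (hterm _)
  have hmem : a ∈ Finset.range (c.natDegree + 1) :=
    Finset.mem_range.2 (Nat.lt_succ_of_le c.natTrailingDegree_le_natDegree)
  rw [← Finset.add_sum_erase _ _ hmem] at hrel
  have hle : |c.coeff a * τ⁻¹ ^ a * G a| ≤ S * (τ⁻¹ ^ (a + 1) * G a) := by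
    rw [eq_neg_of_add_eq_zero_left hrel, abs_neg, Finset.sum_mul]
    refine (Finset.abs_sum_le_sum_abs _ _).trans
      ((Finset.sum_le_sum fun j hj => ?_).trans
        (Finset.sum_le_sum_of_subset_of_nonneg (Finset.erase_subset a _) fun j _ _ => ?_))
    · rcases lt_or_ge j a with hja | hja
      · rw [Polynomial.coeff_eq_zero_of_lt_natTrailingDegree hja]; simp
      · have hja' : a + 1 ≤ j := lt_of_le_of_ne hja (Finset.ne_of_mem_erase hj).symm
        rw [abs_mul, abs_mul, mul_assoc, abs_of_pos (hG0 j),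
          abs_of_pos (a := τ⁻¹ ^ j) (by positivity)]
        refine mul_le_mul_of_nonneg_left ?_ (abs_nonneg _)
        refine mul_le_mul ?_ ?_ (hG0 j).le (by positivity)
        · exact pow_le_pow_of_le_one (by positivity) (inv_le_one_of_one_le₀ h1) hja'
        · exact tail_add_le (a := fun n => s n * τ ^ n) (fun n => (hterm n).le) hs hja
    · have := hG0 a
      positivity
  rw [abs_mul, abs_mul, abs_of_pos (hG0 a), abs_of_pos (a := τ⁻¹ ^ a) (by positivity),
    pow_succ] at hle
  have hp : 0 < τ⁻¹ ^ a * τ⁻¹ * G a := by have := hG0 a; positivity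
  refine le_of_mul_le_mul_right ?_ hp
  calc τ * |c.coeff a| * (τ⁻¹ ^ a * τ⁻¹ * G a) = |c.coeff a| * τ⁻¹ ^ a * G a := by field_simp
    _ ≤ _ := hle

/-- A positive bounded linear recurrence has, near its radius of convergence, tails that decay
slowly. -/
theorem exists_slow_tail {s : ℕ → ℝ} (hpos : ∀ n, 0 < s n) (hle : ∀ n, s n ≤ 1)
    {c : Polynomial ℝ} (hc : c ≠ 0)
    (hrec : ∀ n, ∑ j ∈ Finset.range (c.natDegree + 1), c.coeff j * s (n + j) = 0) (d : ℕ) :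
    ∃ ρ : ℝ, 0 < ρ ∧ ∀ q : ℝ, 0 < q → q < 1 → ∃ τ : ℝ, q * ρ < τ ∧ τ ≤ ρ ∧
      (Summable fun n => s n * τ ^ n) ∧ ∃ N : ℕ,
        q ^ d * ∑' n, s (n + N) * τ ^ (n + N) ≤ ∑' n, s (n + (N + d)) * τ ^ (n + (N + d)) := by
  set R := {τ : ℝ | 0 < τ ∧ Summable fun n => s n * τ ^ n}
  have hbdd : BddAbove R := bddAbove_summable_of_recurrence hpos hc hrec
  have hhalf : (1 / 2 : ℝ) ∈ R := by
    refine ⟨by norm_num, Summable.of_nonneg_of_le (fun n => ?_) (fun n => ?_)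
      (summable_geometric_of_lt_one (by norm_num : (0:ℝ) ≤ 1 / 2) (by norm_num))⟩
    · have := hpos n; positivity
    · exact mul_le_of_le_one_left (by positivity) (hle n)
  have hρ : 0 < sSup R := lt_of_lt_of_le (by norm_num) (le_csSup hbdd hhalf)
  refine ⟨sSup R, hρ, fun q hq0 hq1 => ?_⟩
  obtain ⟨τ, ⟨hτ, hs⟩, hqτ⟩ := exists_lt_of_lt_csSup ⟨_, hhalf⟩ (mul_lt_of_lt_one_left hρ hq1)
  refine ⟨τ, hqτ, le_csSup hbdd ⟨hτ, hs⟩, hs, ?_⟩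
  -- If every tail shrank by `q ^ d` over `d` steps, the terms would be `O(q ^ n)`, and the series
  -- would converge up to `τ / q`, which exceeds the supremum.
  by_contra! hcon
  have hterm : ∀ n, 0 ≤ s n * τ ^ n := fun n => (mul_pos (hpos n) (pow_pos hτ n)).le
  set G : ℕ → ℝ := fun N => ∑' n, s (n + N) * τ ^ (n + N) with hG
  have hanti : ∀ {M N}, M ≤ N → G N ≤ G M := fun h =>
    tail_add_le (a := fun n => s n * τ ^ n) hterm hs h
  have hG0 : 0 ≤ G 0 := tsum_nonneg fun n => hterm _
  have hd : 0 < d := by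
    rcases Nat.eq_zero_or_pos d with rfl | h
    · simpa using hcon 0
    · exact h
  have hbound : ∀ n, G n ≤ q ^ n * ((q ^ d)⁻¹ * G 0) := by
    intro n
    induction n using Nat.strong_induction_on with
    | _ n ih =>
      rcases lt_or_ge n d with h | h
      · refine (hanti n.zero_le).trans ?_
        rw [← mul_assoc]
        refine le_mul_of_one_le_left hG0 ?_
        rw [← div_eq_mul_inv, one_le_div (by positivity)]
        exact pow_le_pow_of_le_one hq0.le hq1.le h.le
      · obtain ⟨m, rfl⟩ := Nat.exists_eq_add_of_le' h
        have h1 := ih m (by omega)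
        calc G (m + d) ≤ q ^ d * G m := (hcon m).le
          _ ≤ q ^ d * (q ^ m * ((q ^ d)⁻¹ * G 0)) := by gcongr
          _ = _ := by ring
  obtain ⟨τ', h1, h2⟩ := exists_between ((lt_div_iff₀' hq0).2 hqτ)
  have hτ' : 0 < τ' := hρ.trans h1
  refine absurd (le_csSup hbdd (a := τ') ⟨hτ', ?_⟩) (not_le.2 h1)
  have hr : q * τ' / τ < 1 := by
    rw [div_lt_one hτ]; rwa [lt_div_iff₀' hq0] at h2
  refine Summable.of_nonneg_of_le (fun n => (mul_pos (hpos n) (pow_pos hτ' n)).le) (fun n => ?_)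
    ((summable_geometric_of_lt_one (by positivity) hr).mul_right ((q ^ d)⁻¹ * G 0))
  have hsn : s n * τ ^ n ≤ G n := by
    have := (summable_nat_add_of hs n).le_tsum 0 fun k _ => hterm (k + n)
    simpa using this
  have := hsn.trans (hbound n)
  calc s n * τ' ^ n = s n * τ ^ n * (τ' / τ) ^ n := by rw [div_pow]; field_simp
    _ ≤ q ^ n * ((q ^ d)⁻¹ * G 0) * (τ' / τ) ^ n := by gcongr
    _ = _ := by rw [mul_div_assoc, mul_pow]; ring

/-! ### Limits of weighted evaluations -/

theorem exists_weightedEval {X : Type*} [TopologicalSpace X] [CompactSpace X] (w : ℕ → ℝ)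
    (hw : Summable fun n => |w n|) (x : ℕ → X) :
    ∃ Λ : C(X, ℂ) →L[ℂ] ℂ, (∀ g, Λ g = ∑' n, (w n : ℂ) * g (x n)) ∧ ‖Λ‖ ≤ ∑' n, |w n| := by
  have hbound : ∀ (g : C(X, ℂ)) n, ‖(w n : ℂ) * g (x n)‖ ≤ |w n| * ‖g‖ := by
    intro g n
    rw [norm_mul, Complex.norm_real, Real.norm_eq_abs]
    exact mul_le_mul_of_nonneg_left (g.norm_coe_le_norm _) (abs_nonneg _)
  have hs : ∀ g : C(X, ℂ), Summable fun n => (w n : ℂ) * g (x n) := fun g =>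
    Summable.of_norm_bounded (hw.mul_right ‖g‖) (hbound g)
  let Λ : C(X, ℂ) →ₗ[ℂ] ℂ :=
    { toFun := fun g => ∑' n, (w n : ℂ) * g (x n)
      map_add' := fun g h => by
        rw [← (hs g).tsum_add (hs h)]
        simp [mul_add]
      map_smul' := fun a g => by
        rw [RingHom.id_apply, smul_eq_mul, ← tsum_mul_left]
        simp [mul_left_comm] }
  have hΛ : ∀ g, ‖Λ g‖ ≤ (∑' n, |w n|) * ‖g‖ := fun g => by
    rw [← tsum_mul_right]
    exact tsum_of_norm_bounded (hw.mul_right ‖g‖).hasSum (hbound g)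
  exact ⟨Λ.mkContinuous _ hΛ, fun g => rfl,
    Λ.mkContinuous_norm_le (tsum_nonneg fun n => abs_nonneg _) hΛ⟩

/-- Banach–Alaoglu. An ultrafilter gives convergence against all test functions at once, without
subsequences. -/
theorem exists_tendsto_of_norm_le_one {X : Type*} [TopologicalSpace X] [CompactSpace X]
    (Λ : ℕ → C(X, ℂ) →L[ℂ] ℂ) (hΛ : ∀ i, ‖Λ i‖ ≤ 1) (U : Ultrafilter ℕ) :
    ∃ Ψ : C(X, ℂ) →L[ℂ] ℂ, ∀ g, Tendsto (fun i => Λ i g) U (𝓝 (Ψ g)) := by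
  have hK := WeakDual.isCompact_closedBall (𝕜 := ℂ) (E := C(X, ℂ)) 0 1
  obtain ⟨Ψ, -, hΨ⟩ := hK.ultrafilter_le_nhds
    (U.map fun i => StrongDual.toWeakDual (Λ i)) (by
      rw [Filter.le_principal_iff]
      refine Filter.mem_map.2 (Filter.univ_mem' fun i => ?_)
      simpa using hΛ i)
  refine ⟨WeakDual.toStrongDual Ψ, fun g => ?_⟩
  exact ((WeakDual.eval_continuous g).tendsto Ψ).comp hΨ

/-- The average, against the sequence `x` relative to `s`, of the values of `u` beyond `N`, with
geometric weights of ratio `τ`. -/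
noncomputable def tailMean (s x : ℕ → ℝ) (τ : ℝ) (N : ℕ) (u : ℕ → ℂ) : ℂ :=
  (∑' n, ((x (n + N) * τ ^ (n + N) : ℝ) : ℂ) * u (n + N)) /
    ((∑' n, s (n + N) * τ ^ (n + N) : ℝ) : ℂ)

theorem exists_tendsto_tailMean {X : Type*} [TopologicalSpace X] [CompactSpace X] (y : ℕ → X)
    {s x : ℕ → ℝ} (hx : ∀ n, |x n| ≤ s n) {τ : ℕ → ℝ} (hτ : ∀ i, 0 < τ i)
    (hs : ∀ i, Summable fun n => s n * τ i ^ n) (N : ℕ → ℕ) (U : Ultrafilter ℕ) :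
    ∃ Ψ : C(X, ℂ) →L[ℂ] ℂ, ∀ g : C(X, ℂ),
      Tendsto (fun i => tailMean s x (τ i) (N i) fun n => g (y n)) U (𝓝 (Ψ g)) := by
  have hle : ∀ i n, |x n * τ i ^ n| ≤ s n * τ i ^ n := fun i n => by
    rw [abs_mul, abs_of_pos (pow_pos (hτ i) n)]
    exact mul_le_mul_of_nonneg_right (hx n) (pow_pos (hτ i) n).le
  have hN : ∀ i, Summable fun n => |x (n + N i) * τ i ^ (n + N i)| := fun i =>
    Summable.of_nonneg_of_le (fun _ => abs_nonneg _) (fun n => hle i _)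
      (summable_nat_add_of (hs i) (N i))
  choose Λ hΛ hΛn using fun i => exists_weightedEval (fun n => x (n + N i) * τ i ^ (n + N i)) (hN i)
    fun n => y (n + N i)
  have hG0 : ∀ i, 0 ≤ ∑' n, s (n + N i) * τ i ^ (n + N i) := fun i =>
    tsum_nonneg fun n => (abs_nonneg _).trans (hle i _)
  have hΛ1 : ∀ i, ‖((∑' n, s (n + N i) * τ i ^ (n + N i) : ℝ) : ℂ)⁻¹ • Λ i‖ ≤ 1 := by
    intro i
    rw [norm_smul, norm_inv, Complex.norm_real, Real.norm_eq_abs, abs_of_nonneg (hG0 i)]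
    refine inv_mul_le_one_of_le₀ ((hΛn i).trans ?_) (hG0 i)
    exact (hN i).tsum_le_tsum (fun n => hle i _) (summable_nat_add_of (hs i) (N i))
  obtain ⟨Ψ, hΨ⟩ := exists_tendsto_of_norm_le_one _ hΛ1 U
  refine ⟨Ψ, fun g => (hΨ g).congr fun i => ?_⟩
  simp [tailMean, hΛ, div_eq_inv_mul]

/-- The averages of a linear recurrence against a character nearly vanish unless the corresponding
point is a root of the characteristic polynomial. -/
theorem norm_aeval_mul_tailMean_le {s x : ℕ → ℝ} (hx : ∀ n, |x n| ≤ s n) (hpos : ∀ n, 0 < s n)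
    {c : Polynomial ℝ}
    (hrec : ∀ n, ∑ j ∈ Finset.range (c.natDegree + 1), c.coeff j * x (n + j) = 0) {τ : ℝ}
    (hτ : 0 < τ) (hs : Summable fun n => s n * τ ^ n) {N : ℕ} {q : ℝ}
    (hq : q ^ c.natDegree * ∑' n, s (n + N) * τ ^ (n + N) ≤
      ∑' n, s (n + (N + c.natDegree)) * τ ^ (n + (N + c.natDegree))) {e : ℂ} (he : ‖e‖ = 1) :
    ‖Polynomial.aeval ((τ * e : ℂ)⁻¹) c * tailMean s x τ N fun n => e ^ n‖ ≤
      (∑ j ∈ Finset.range (c.natDegree + 1), |c.coeff j| * τ⁻¹ ^ j) * (1 - q ^ c.natDegree) := by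
  have he0 : e ≠ 0 := norm_ne_zero_iff.1 (by rw [he]; norm_num)
  have hterm : ∀ n, 0 < s n * τ ^ n := fun n => mul_pos (hpos n) (pow_pos hτ n)
  have hb : ∀ n, ‖(x n : ℂ) * (τ * e) ^ n‖ ≤ s n * τ ^ n := fun n => by
    rw [norm_mul, norm_pow, norm_mul, he, mul_one, Complex.norm_real, Complex.norm_real,
      Real.norm_eq_abs, Real.norm_eq_abs, abs_of_pos hτ]
    exact mul_le_mul_of_nonneg_right (hx n) (pow_pos hτ n).le
  have hrel := sum_coeff_mul_tail_eq_zero (fun j => (c.coeff j : ℂ)) (fun n => (x n : ℂ)) _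
    (fun n => by exact_mod_cast hrec n) (mul_ne_zero (Complex.ofReal_ne_zero.2 hτ.ne') he0)
    (Summable.of_norm_bounded hs hb) N
  set G : ℕ → ℝ := fun N => ∑' n, s (n + N) * τ ^ (n + N) with hG
  set B : ℕ → ℂ := fun N => ∑' n, (x (n + N) : ℂ) * (τ * e) ^ (n + N) with hB
  have hGpos : 0 < G N := (summable_nat_add_of hs N).tsum_pos (fun n => (hterm _).le) 0 (hterm _)
  have hmean : (tailMean s x τ N fun n => e ^ n) = B N / (G N : ℂ) := by
    simp only [tailMean, hB, hG, mul_pow]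
    congr 1
    refine tsum_congr fun n => ?_
    push_cast
    ring
  -- Subtracting the vanishing relation between the tails `B (N + j)` leaves only differences of
  -- tails. Each is bounded by the mass of `s` in a block of at most `c.natDegree` terms, which is
  -- small by `hq`.
  have hmul : Polynomial.aeval ((τ * e : ℂ)⁻¹) c * B N =
      ∑ j ∈ Finset.range (c.natDegree + 1),
        (c.coeff j : ℂ) * ((τ * e : ℂ)⁻¹) ^ j * (B N - B (N + j)) := by
    simp only [mul_sub, Finset.sum_sub_distrib]
    rw [hrel, sub_zero, Polynomial.aeval_eq_sum_range, Finset.sum_mul]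
    simp
  rw [hmean, ← mul_div_assoc, hmul, norm_div, Complex.norm_real, Real.norm_eq_abs,
    abs_of_pos hGpos, div_le_iff₀ hGpos, mul_assoc, Finset.sum_mul]
  refine norm_sum_le_of_le _ fun j hj => ?_
  rw [norm_mul, norm_mul, norm_pow, norm_inv, norm_mul, he, mul_one, Complex.norm_real,
    Complex.norm_real, Real.norm_eq_abs, Real.norm_eq_abs, abs_of_pos hτ]
  refine mul_le_mul_of_nonneg_left ?_ (by positivity)
  have h1 : G (N + c.natDegree) ≤ G (N + j) :=
    tail_add_le (a := fun n => s n * τ ^ n) (fun n => (hterm n).le) hs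
      (by have := Finset.mem_range.1 hj; omega)
  have h2 : ‖B N - B (N + j)‖ ≤ G N - G (N + j) :=
    norm_tail_sub_tail_le (b := fun n => (x n : ℂ) * (τ * e) ^ n) (a := fun n => s n * τ ^ n) hb hs N j
  have h3 : q ^ c.natDegree * G N ≤ G (N + c.natDegree) := hq
  linarith

/-- Simultaneous asymptotic averages along a rotation of sequences that satisfy a linear
recurrence and are dominated by a positive one. -/
theorem exists_asymptotic_functionals {s t : ℕ → ℝ} (hpos : ∀ n, 0 < s n) (hle : ∀ n, s n ≤ 1)
    (hts : ∀ n, |t n| ≤ s n) {c : Polynomial ℝ} (hc : c ≠ 0)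
    (hs : ∀ n, ∑ j ∈ Finset.range (c.natDegree + 1), c.coeff j * s (n + j) = 0)
    (ht : ∀ n, ∑ j ∈ Finset.range (c.natDegree + 1), c.coeff j * t (n + j) = 0)
    (θ : UnitAddCircle) :
    ∃ (ρ : ℝ) (S T : C(UnitAddCircle, ℂ) →L[ℂ] ℂ), 0 < ρ ∧ S 1 = 1 ∧
      (∀ l : ℤ, Polynomial.aeval ((ρ * fourier l θ : ℂ)⁻¹) c ≠ 0 →
        S (fourier l) = 0 ∧ T (fourier l) = 0) ∧
      ∀ (α β : ℝ) (h : C(UnitAddCircle, ℝ)), (∀ n : ℕ, 0 ≤ (α * s n + β * t n) * h (n • θ)) →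
        0 ≤ (α * S ((ContinuousMap.mk _ Complex.continuous_ofReal).comp h) +
          β * T ((ContinuousMap.mk _ Complex.continuous_ofReal).comp h)).re := by
  obtain ⟨ρ, hρ, hslow⟩ := exists_slow_tail hpos hle hc hs c.natDegree
  -- The ratios `1 - 1/(i+2)` lie strictly between 0 and 1 from `i = 0` on and tend to 1.
  have hq0 : ∀ i : ℕ, (0 : ℝ) < 1 - 1 / (i + 2) := fun i => by
    rw [sub_pos, div_lt_one (by positivity)]; linarith [(Nat.cast_nonneg i : (0 : ℝ) ≤ i)]
  have hq1 : ∀ i : ℕ, (1 : ℝ) - 1 / (i + 2) < 1 := fun i => by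
    have : (0 : ℝ) < 1 / (i + 2) := by positivity
    linarith
  have hq : Tendsto (fun i : ℕ => (1 : ℝ) - 1 / (i + 2)) atTop (𝓝 1) := by
    have := (tendsto_const_nhds (x := (1 : ℝ))).sub
      (tendsto_one_div_add_atTop_nhds_zero_nat (𝕜 := ℝ) |>.comp (tendsto_add_atTop_nat 1))
    simp only [sub_zero] at this
    refine this.congr fun i => ?_
    simp only [Function.comp]
    push_cast
    ring_nf
  choose τ hτ1 hτ2 hτs N hN using fun i : ℕ => hslow _ (hq0 i) (hq1 i)
  have hτ0 : ∀ i, 0 < τ i := fun i => (mul_pos (hq0 i) hρ).trans (hτ1 i)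
  have hτ : Tendsto τ atTop (𝓝 ρ) := by
    refine tendsto_of_tendsto_of_tendsto_of_le_of_le (by simpa using hq.mul_const ρ)
      tendsto_const_nhds (fun i => (hτ1 i).le) hτ2
  have hss : ∀ n, |s n| ≤ s n := fun n => (abs_of_pos (hpos n)).le
  -- One ultrafilter serves both limits, so inequalities combining `s` and `t` survive in `S` and
  -- `T`.
  let U := hyperfilter ℕ
  have hU : (U : Filter ℕ) ≤ atTop := by
    rw [← Nat.cofinite_eq_atTop]; exact hyperfilter_le_cofinite
  obtain ⟨S, hS⟩ := exists_tendsto_tailMean (fun n => n • θ) hss hτ0 hτs N U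
  obtain ⟨T, hT⟩ := exists_tendsto_tailMean (fun n => n • θ) hts hτ0 hτs N U
  have hterm : ∀ i n, 0 < s n * τ i ^ n := fun i n => mul_pos (hpos n) (pow_pos (hτ0 i) n)
  have hG : ∀ i, 0 < ∑' n, s (n + N i) * τ i ^ (n + N i) := fun i =>
    (summable_nat_add_of (hτs i) (N i)).tsum_pos (fun n => (hterm i _).le) 0 (hterm i _)
  have hspec : ∀ (x : ℕ → ℝ) (Ψ : C(UnitAddCircle, ℂ) →L[ℂ] ℂ), (∀ n, |x n| ≤ s n) →
      (∀ n, ∑ j ∈ Finset.range (c.natDegree + 1), c.coeff j * x (n + j) = 0) →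
      (∀ g : C(UnitAddCircle, ℂ),
        Tendsto (fun i => tailMean s x (τ i) (N i) fun n => g (n • θ)) U (𝓝 (Ψ g))) →
      ∀ l : ℤ, Polynomial.aeval ((ρ * fourier l θ : ℂ)⁻¹) c ≠ 0 → Ψ (fourier l) = 0 := by
    intro x Ψ hx hrec hΨ l hl
    have hchar : ∀ n : ℕ, (fourier l (n • θ) : ℂ) = fourier l θ ^ n := fun n => by
      rw [fourier_apply, fourier_apply, smul_comm, AddCircle.toCircle_nsmul, Circle.coe_pow]
    have hnorm : ‖(fourier l θ : ℂ)‖ = 1 := by rw [fourier_apply]; exact Circle.norm_coe _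
    have h0 : (fourier l θ : ℂ) ≠ 0 := norm_ne_zero_iff.1 (by rw [hnorm]; norm_num)
    have h1 := hΨ (fourier l)
    simp only [hchar] at h1
    have hbound := fun i => norm_aeval_mul_tailMean_le hx hpos hrec (hτ0 i) (hτs i) (hN i) hnorm
    have hinv : Tendsto (fun i => ((τ i : ℂ) * fourier l θ)⁻¹) atTop
        (𝓝 ((ρ * fourier l θ : ℂ)⁻¹)) :=
      ((((Complex.continuous_ofReal.tendsto ρ).comp hτ).mul_const _)).inv₀
        (mul_ne_zero (Complex.ofReal_ne_zero.2 hρ.ne') h0)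
    have hpoly : Tendsto (fun i => Polynomial.aeval (((τ i : ℂ) * fourier l θ)⁻¹) c) atTop
        (𝓝 (Polynomial.aeval ((ρ * fourier l θ : ℂ)⁻¹) c)) :=
      (c.continuous_aeval.tendsto _).comp hinv
    have hrhs : Tendsto (fun i => (∑ j ∈ Finset.range (c.natDegree + 1),
        |c.coeff j| * (τ i)⁻¹ ^ j) * (1 - (1 - 1 / ((i : ℝ) + 2)) ^ c.natDegree)) atTop
        (𝓝 ((∑ j ∈ Finset.range (c.natDegree + 1), |c.coeff j| * ρ⁻¹ ^ j) *
          (1 - 1 ^ c.natDegree))) :=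
      (tendsto_finsetSum _ fun j _ => ((hτ.inv₀ hρ.ne').pow j).const_mul _).mul
        (tendsto_const_nhds.sub (hq.pow _))
    rw [one_pow, sub_self, mul_zero] at hrhs
    have hz := squeeze_zero_norm hbound hrhs
    have := tendsto_nhds_unique ((hpoly.mono_left hU).mul h1) (hz.mono_left hU)
    exact (mul_eq_zero.1 this).resolve_left hl
  refine ⟨ρ, S, T, hρ, ?_, fun l hl => ⟨hspec s S hss hs hS l hl, hspec t T hts ht hT l hl⟩,
    fun α β h hh => ?_⟩
  · refine tendsto_nhds_unique (hS 1) (tendsto_const_nhds.congr fun i => ?_)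
    have := hG i
    simp only [tailMean, ContinuousMap.one_apply, mul_one, ← Complex.ofReal_tsum]
    rw [div_self (Complex.ofReal_ne_zero.2 (hG i).ne')]
  · have hlim := (Complex.continuous_re.tendsto _).comp
      (((hS ((ContinuousMap.mk _ Complex.continuous_ofReal).comp h)).const_mul (α : ℂ)).add
      ((hT ((ContinuousMap.mk _ Complex.continuous_ofReal).comp h)).const_mul (β : ℂ)))
    refine ge_of_tendsto' hlim fun i => ?_
    have hsum : ∀ x : ℕ → ℝ, (∀ n, |x n| ≤ s n) →
        Summable fun n => x (n + N i) * τ i ^ (n + N i) * h ((n + N i) • θ) := by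
      intro x hx
      refine Summable.of_norm_bounded ((summable_nat_add_of (hτs i) (N i)).mul_right ‖h‖)
        fun n => ?_
      rw [norm_mul, norm_mul, Real.norm_eq_abs, Real.norm_eq_abs,
        abs_of_pos (pow_pos (hτ0 i) (n + N i))]
      have h1 := hx (n + N i)
      have h2 := h.norm_coe_le_norm ((n + N i) • θ)
      have h3 := pow_pos (hτ0 i) (n + N i)
      have h4 := (hpos (n + N i)).le
      gcongr
    have hval : ∀ x : ℕ → ℝ, tailMean s x (τ i) (N i) (fun n =>
        ((ContinuousMap.mk _ Complex.continuous_ofReal).comp h : C(UnitAddCircle, ℂ)) (n • θ)) =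
        (((∑' n, x (n + N i) * τ i ^ (n + N i) * h ((n + N i) • θ)) /
          ∑' n, s (n + N i) * τ i ^ (n + N i) : ℝ) : ℂ) := by
      intro x
      simp [tailMean, Complex.ofReal_tsum]
    simp only [Function.comp, hval]
    norm_cast
    rw [← mul_div_assoc, ← mul_div_assoc, ← add_div]
    refine div_nonneg ?_ (hG i).le
    rw [← tsum_mul_left, ← tsum_mul_left,
      ← ((hsum s hss).mul_left α).tsum_add ((hsum t hts).mul_left β)]
    refine tsum_nonneg fun n => ?_
    have := mul_nonneg (hh (n + N i)) (pow_pos (hτ0 i) (n + N i)).le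
    linarith

/-! ### Functionals with finite spectrum on the circle -/

/-- The trigonometric polynomial that represents a functional with spectrum in `F`. -/
noncomputable def trigDensity (F : Finset ℤ) (Ψ : C(UnitAddCircle, ℂ) →L[ℂ] ℂ) :
    C(UnitAddCircle, ℂ) :=
  ∑ l ∈ F, Ψ (fourier l) • fourier (-l)

theorem integrable_of_continuousMap {E : Type*} [NormedAddCommGroup E] (g : C(UnitAddCircle, E)) :
    MeasureTheory.Integrable g AddCircle.haarAddCircle :=
  g.continuous.integrable_of_hasCompactSupport (HasCompactSupport.of_compactSpace g)

/-- Both sides are continuous in `g` and agree on the Fourier monomials by orthogonality; these span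
a dense subspace. -/
theorem apply_eq_integral_trigDensity (F : Finset ℤ) (Ψ : C(UnitAddCircle, ℂ) →L[ℂ] ℂ)
    (hF : ∀ l ∉ F, Ψ (fourier l) = 0) (g : C(UnitAddCircle, ℂ)) :
    Ψ g = ∫ x, g x * trigDensity F Ψ x ∂AddCircle.haarAddCircle := by
  let I : C(UnitAddCircle, ℂ) →ₗ[ℂ] ℂ :=
    { toFun := fun g => ∫ x, (g * trigDensity F Ψ) x ∂AddCircle.haarAddCircle
      map_add' := fun g h => by
        rw [add_mul, ← MeasureTheory.integral_add (integrable_of_continuousMap _)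
          (integrable_of_continuousMap _)]
        rfl
      map_smul' := fun a g => by
        rw [RingHom.id_apply, ← MeasureTheory.integral_smul, smul_mul_assoc]
        rfl }
  have hI : ∀ g, ‖I g‖ ≤ ‖trigDensity F Ψ‖ * ‖g‖ := fun g => by
    refine (MeasureTheory.norm_integral_le_of_norm_le_const (C := ‖trigDensity F Ψ‖ * ‖g‖)
      (Eventually.of_forall fun x => ?_)).trans (by simp)
    rw [mul_comm ‖trigDensity F Ψ‖]
    exact ((g * trigDensity F Ψ).norm_coe_le_norm x).trans (norm_mul_le _ _)
  suffices h : Ψ = I.mkContinuous _ hI by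
    conv_lhs => rw [h]
    rfl
  refine ContinuousLinearMap.ext_on (s := Set.range (@fourier 1)) ?_ ?_
  · rw [Submodule.dense_iff_topologicalClosure_eq_top]
    exact span_fourier_closure_eq_top
  · rintro _ ⟨m, rfl⟩
    have h1 : I (fourier m) =
        ∑ l ∈ F, Ψ (fourier l) * fourierCoeff (fourier m : UnitAddCircle → ℂ) l := by
      change ∫ x, ((fourier m : C(UnitAddCircle, ℂ)) * trigDensity F Ψ) x ∂AddCircle.haarAddCircle = _
      simp only [fourierCoeff, smul_eq_mul, ← MeasureTheory.integral_const_mul]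
      rw [← MeasureTheory.integral_finsetSum]
      · refine MeasureTheory.integral_congr_ae (Eventually.of_forall fun x => ?_)
        simp only [trigDensity, ContinuousMap.mul_apply, ContinuousMap.sum_apply,
          ContinuousMap.smul_apply, smul_eq_mul, Finset.mul_sum]
        exact Finset.sum_congr rfl fun l _ => by ring
      · intro l _
        have := (integrable_of_continuousMap
          ((fourier (-l) : C(UnitAddCircle, ℂ)) * fourier m)).const_mul (Ψ (fourier l))
        simpa only [ContinuousMap.mul_apply] using this
    rw [LinearMap.mkContinuous_apply, h1]
    simp only [fourierCoeff_fourier, Pi.single_apply, mul_ite, mul_one, mul_zero]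
    rw [Finset.sum_ite_eq' F m]
    split_ifs with h
    · rfl
    · exact hF m h

/-- The real part of a trigonometric polynomial. -/
noncomputable def reDensity (F : Finset ℤ) (Ψ : C(UnitAddCircle, ℂ) →L[ℂ] ℂ) :
    C(UnitAddCircle, ℝ) :=
  (ContinuousMap.mk _ Complex.continuous_re).comp (trigDensity F Ψ)

theorem re_apply_eq_integral_reDensity (F : Finset ℤ) (Ψ : C(UnitAddCircle, ℂ) →L[ℂ] ℂ)
    (hF : ∀ l ∉ F, Ψ (fourier l) = 0) (h : C(UnitAddCircle, ℝ)) :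
    (Ψ ((ContinuousMap.mk _ Complex.continuous_ofReal).comp h)).re =
      ∫ x, h x * reDensity F Ψ x ∂AddCircle.haarAddCircle := by
  rw [apply_eq_integral_trigDensity F Ψ hF]
  have := integral_re (𝕜 := ℂ) (integrable_of_continuousMap
    ((ContinuousMap.mk _ Complex.continuous_ofReal).comp h * trigDensity F Ψ))
  refine this.symm.trans ?_
  refine MeasureTheory.integral_congr_ae (Eventually.of_forall fun x => ?_)
  simp [reDensity]

theorem analyticAt_reDensity (F : Finset ℤ) (Ψ : C(UnitAddCircle, ℂ) →L[ℂ] ℂ) (y : ℝ) :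
    AnalyticAt ℝ (fun y : ℝ => reDensity F Ψ (y : UnitAddCircle)) y := by
  have h1 : ∀ l : ℤ, AnalyticAt ℝ
      (fun y : ℝ => Ψ (fourier l) * Complex.exp (2 * Real.pi * Complex.I * (-l : ℤ) * y)) y := by
    intro l
    refine analyticAt_const.mul ?_
    refine (analyticAt_cexp.restrictScalars (𝕜 := ℝ)).fun_comp ?_
    exact analyticAt_const.mul (Complex.ofRealCLM.analyticAt y)
  have h2 := (Complex.reCLM.analyticAt _).fun_comp (Finset.analyticAt_fun_sum F fun l _ => h1 l)
  refine h2.congr (Eventually.of_forall fun y => ?_)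
  change Complex.re _ = Complex.re (trigDensity F Ψ y)
  congr 1
  rw [trigDensity, ContinuousMap.sum_apply]
  refine Finset.sum_congr rfl fun l _ => ?_
  rw [ContinuousMap.smul_apply, fourier_coe_apply, smul_eq_mul, Complex.ofReal_one, div_one]

/-- A continuous function on the circle is nonnegative where `k` is positive if it has nonnegative
integral against all products of the positive part of `k` with nonnegative functions. -/
theorem nonneg_of_forall_integral_nonneg (B k : C(UnitAddCircle, ℝ))
    (h : ∀ g : C(UnitAddCircle, ℝ), (∀ x, 0 ≤ g x) →
      0 ≤ ∫ x, g x * max (k x) 0 * B x ∂AddCircle.haarAddCircle)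
    {x : UnitAddCircle} (hx : 0 < k x) : 0 ≤ B x := by
  by_contra! hB
  -- With the negative part of `B` as test function, the integrand becomes minus the square of that
  -- part times the positive part of `k`.
  let f : UnitAddCircle → ℝ := fun x => max (-B x) 0 * max (k x) 0 * max (-B x) 0
  have hf : Continuous f := by fun_prop
  have hf0 : ∀ x, 0 ≤ f x := fun x => by positivity
  have hpos : 0 < ∫ x, f x ∂AddCircle.haarAddCircle := by
    refine hf.integral_pos_of_hasCompactSupport_nonneg_nonzero
      (HasCompactSupport.of_compactSpace f) hf0 (x := x) (ne_of_gt ?_)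
    have h1 : 0 < max (-B x) 0 := lt_max_of_lt_left (neg_pos.2 hB)
    have h2 : 0 < max (k x) 0 := lt_max_of_lt_left hx
    positivity
  have h1 := h ⟨fun x => max (-B x) 0, by fun_prop⟩ fun x => le_max_right _ _
  have h2 : ∫ x, max (-B x) 0 * max (k x) 0 * B x ∂AddCircle.haarAddCircle =
      -∫ x, f x ∂AddCircle.haarAddCircle := by
    rw [← MeasureTheory.integral_neg]
    refine MeasureTheory.integral_congr_ae (Eventually.of_forall fun x => ?_)
    simp only [f]
    rcases le_total (B x) 0 with hb | hb
    · rw [max_eq_left (neg_nonneg.2 hb)]; ring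
    · rw [max_eq_right (neg_nonpos.2 hb)]; ring
  simp only [ContinuousMap.coe_mk] at h1
  linarith

/-- Analytic functions with `|ζ| ≤ σ` such that `κ σ ≤ ζ` to the left of a point and `κ σ ≤ -ζ` to
the right of it vanish near that point. -/
theorem eventually_eq_zero_of_sign_change {σ ζ : ℝ → ℝ} {a κ : ℝ} (hκ : 0 < κ)
    (hσ : AnalyticAt ℝ σ a) (hζ : AnalyticAt ℝ ζ a) (hle : ∀ᶠ y in 𝓝 a, |ζ y| ≤ σ y)
    (hl : ∀ᶠ y in 𝓝[<] a, κ * σ y ≤ ζ y) (hr : ∀ᶠ y in 𝓝[>] a, κ * σ y ≤ -ζ y) :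
    ∀ᶠ y in 𝓝 a, σ y = 0 := by
  refine hσ.eventually_eq_zero_or_eventually_ne_zero.resolve_right fun hne => ?_
  have hpos : ∀ᶠ y in 𝓝[≠] a, 0 < σ y ∧ |ζ y / σ y| ≤ 1 := by
    filter_upwards [hne, hle.filter_mono nhdsWithin_le_nhds] with y h1 h2
    have h3 : 0 < σ y := lt_of_le_of_ne ((abs_nonneg _).trans h2) h1.symm
    exact ⟨h3, by rwa [abs_div, abs_of_pos h3, div_le_one h3]⟩
  have hmer : MeromorphicAt (fun y => ζ y / σ y) a := hζ.meromorphicAt.fun_div hσ.meromorphicAt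
  -- A pole would contradict boundedness; without one, the quotient has a single limit from both
  -- sides.
  have hord : 0 ≤ meromorphicOrderAt (fun y => ζ y / σ y) a := by
    by_contra! hneg
    have h1 := tendsto_norm_cobounded_atTop.comp (tendsto_cobounded_of_meromorphicOrderAt_neg hneg)
    obtain ⟨y, h2, h3⟩ := ((h1.eventually_gt_atTop 1).and hpos).exists
    exact absurd h3.2 (not_le.2 h2)
  obtain ⟨b, hb⟩ := tendsto_nhds_of_meromorphicOrderAt_nonneg hmer hord
  have hlt : 𝓝[<] a ≤ 𝓝[≠] a := nhdsWithin_mono _ fun y hy => ne_of_lt hy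
  have hgt : 𝓝[>] a ≤ 𝓝[≠] a := nhdsWithin_mono _ fun y hy => ne_of_gt hy
  have h1 : κ ≤ b := by
    refine ge_of_tendsto (hb.mono_left hlt) ?_
    filter_upwards [hl, hlt hpos] with y h1 h2
    rwa [le_div_iff₀ h2.1]
  have h2 : b ≤ -κ := by
    refine le_of_tendsto (hb.mono_left hgt) ?_
    filter_upwards [hr, hgt hpos] with y h1 h2
    rw [div_le_iff₀ h2.1]
    linarith
  linarith

/-- Since `θ` has infinite order, distinct `l` give distinct points, and a nonzero polynomial has
finitely many roots. -/
theorem finite_setOf_aeval_fourier_eq_zero {c : Polynomial ℝ} (hc : c ≠ 0) {ρ : ℝ} (hρ : 0 < ρ)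
    {θ : UnitAddCircle} (hθ : ∀ n : ℤ, n ≠ 0 → n • θ ≠ 0) :
    {l : ℤ | Polynomial.aeval ((ρ * fourier l θ : ℂ)⁻¹) c = 0}.Finite := by
  have hinj : Function.Injective fun l : ℤ => (ρ * fourier l θ : ℂ)⁻¹ := by
    intro l m hlm
    have h1 := mul_left_cancel₀ (Complex.ofReal_ne_zero.2 hρ.ne') (inv_injective hlm)
    rw [fourier_apply, fourier_apply] at h1
    have h2 := AddCircle.injective_toCircle one_ne_zero (Circle.coe_injective h1)
    by_contra hne
    exact hθ (l - m) (sub_ne_zero.2 hne) (by rw [sub_smul, h2, sub_self])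
  refine ((c.rootSet_finite ℂ).preimage hinj.injOn).subset fun l hl => ?_
  rw [Set.mem_preimage, Polynomial.mem_rootSet]
  exact ⟨hc, hl⟩

/-- Two sequences satisfying a common linear recurrence cannot recognize with a relative gap the
sign of the cosine along an irrational rotation. -/
theorem false_of_recurrence_of_cos_sign {s t : ℕ → ℝ} (hpos : ∀ n, 0 < s n) (hle : ∀ n, s n ≤ 1)
    (hts : ∀ n, |t n| ≤ s n) {c : Polynomial ℝ} (hc : c ≠ 0)
    (hs : ∀ n, ∑ j ∈ Finset.range (c.natDegree + 1), c.coeff j * s (n + j) = 0)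
    (ht : ∀ n, ∑ j ∈ Finset.range (c.natDegree + 1), c.coeff j * t (n + j) = 0)
    {θ : ℝ} (hθ : Irrational θ) {κ : ℝ} (hκ : 0 < κ)
    (hcos : ∀ n : ℕ, 0 < Real.cos (2 * Real.pi * (n * θ)) → κ * s n ≤ t n)
    (hcos' : ∀ n : ℕ, Real.cos (2 * Real.pi * (n * θ)) ≤ 0 → κ * s n ≤ -t n) : False := by
  obtain ⟨ρ, S, T, hρ, hS1, hspec, hnonneg⟩ :=
    exists_asymptotic_functionals hpos hle hts hc hs ht (θ : UnitAddCircle)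
  have hθ' : ∀ n : ℤ, n ≠ 0 → n • (θ : UnitAddCircle) ≠ 0 := by
    intro n hn h
    rw [← AddCircle.coe_zsmul, AddCircle.coe_eq_zero_iff] at h
    obtain ⟨m, hm⟩ := h
    refine (hθ.intCast_mul hn).ne_int m ?_
    simpa using hm.symm
  set F := (finite_setOf_aeval_fourier_eq_zero hc hρ hθ').toFinset with hF
  have hFmem : ∀ l ∉ F, S (fourier l) = 0 ∧ T (fourier l) = 0 := fun l hl =>
    hspec l fun h0 => hl (by rw [hF, Set.Finite.mem_toFinset]; exact h0)
  set σ := reDensity F S with hσ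
  set ζ := reDensity F T with hζ
  have hint : ∀ (α β : ℝ) (h : C(UnitAddCircle, ℝ)),
      (∀ n : ℕ, 0 ≤ (α * s n + β * t n) * h (n • (θ : UnitAddCircle))) →
      0 ≤ ∫ x, h x * (α * σ x + β * ζ x) ∂AddCircle.haarAddCircle := by
    intro α β h hh
    have h1 := hnonneg α β h hh
    rw [Complex.add_re, Complex.re_ofReal_mul, Complex.re_ofReal_mul,
      re_apply_eq_integral_reDensity F S fun l hl => (hFmem l hl).1,
      re_apply_eq_integral_reDensity F T fun l hl => (hFmem l hl).2,
      ← MeasureTheory.integral_const_mul, ← MeasureTheory.integral_const_mul] at h1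
    have h2 := MeasureTheory.integral_add ((integrable_of_continuousMap (h * σ)).const_mul α)
      ((integrable_of_continuousMap (h * ζ)).const_mul β)
    simp only [ContinuousMap.mul_apply] at h2
    rw [← h2] at h1
    refine h1.trans_eq (MeasureTheory.integral_congr_ae (Eventually.of_forall fun x => ?_))
    simp only
    ring
  -- Test functions multiplied by the positive part of `k` vanish at every `nθ` where the inequality
  -- is not assumed.
  have hpt : ∀ (α β : ℝ) (k : C(UnitAddCircle, ℝ)),
      (∀ n : ℕ, 0 < k (n • (θ : UnitAddCircle)) → 0 ≤ α * s n + β * t n) →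
      ∀ x, 0 < k x → 0 ≤ α * σ x + β * ζ x := by
    intro α β k hk x hx
    refine nonneg_of_forall_integral_nonneg
      (ContinuousMap.const _ α * σ + ContinuousMap.const _ β * ζ) k (fun g hg => ?_) hx
    refine hint α β (g * ⟨fun x => max (k x) 0, by fun_prop⟩) fun n => ?_
    rcases lt_or_ge 0 (k (n • (θ : UnitAddCircle))) with h | h
    · exact mul_nonneg (hk n h) (mul_nonneg (hg _) (le_max_right _ _))
    · simp [max_eq_right h]
  have habs : ∀ x, |ζ x| ≤ σ x := by
    intro x
    have h1 := hpt 1 1 1 (fun n _ => by linarith [neg_le_of_abs_le (hts n)]) x one_pos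
    have h2 := hpt 1 (-1) 1 (fun n _ => by linarith [le_of_abs_le (hts n)]) x one_pos
    rw [abs_le]
    constructor <;> linarith
  let k : C(UnitAddCircle, ℝ) := (ContinuousMap.mk _ Complex.continuous_re).comp (fourier 1)
  have hk : ∀ y : ℝ, k (y : UnitAddCircle) = Real.cos (2 * Real.pi * y) := by
    intro y
    change ((fourier 1 (y : UnitAddCircle) : ℂ)).re = _
    rw [fourier_coe_apply]
    have : (2 * Real.pi * Complex.I * (1 : ℤ) * y / (1 : ℝ) : ℂ) =
        ((2 * Real.pi * y : ℝ) : ℂ) * Complex.I := by push_cast; ring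
    rw [this, Complex.exp_ofReal_mul_I_re]
  have hkn : ∀ n : ℕ, k (n • (θ : UnitAddCircle)) = Real.cos (2 * Real.pi * (n * θ)) := by
    intro n
    rw [← AddCircle.coe_nsmul, hk, nsmul_eq_mul]
  have hleft : ∀ y : ℝ, 0 < Real.cos (2 * Real.pi * y) →
      κ * σ (y : UnitAddCircle) ≤ ζ (y : UnitAddCircle) := by
    intro y hy
    have := hpt (-κ) 1 k (fun n hn => by linarith [hcos n (by rwa [← hkn])]) y (by rwa [hk])
    linarith
  have hright : ∀ y : ℝ, Real.cos (2 * Real.pi * y) < 0 →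
      κ * σ (y : UnitAddCircle) ≤ -ζ (y : UnitAddCircle) := by
    intro y hy
    have := hpt (-κ) (-1) (-k) (fun n hn => by
      rw [ContinuousMap.neg_apply, hkn] at hn
      linarith [hcos' n (by linarith)]) y (by rw [ContinuousMap.neg_apply, hk]; linarith)
    linarith
  have hσan := analyticAt_reDensity F S
  have hπ := Real.pi_pos
  -- The cosine changes sign from positive to negative at `y = 1/4`.
  have hzero : ∀ᶠ y : ℝ in 𝓝 (1 / 4), σ (y : UnitAddCircle) = 0 := by
    refine eventually_eq_zero_of_sign_change (ζ := fun y : ℝ => ζ (y : UnitAddCircle)) hκ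
      (hσan _) (analyticAt_reDensity F T _) (Eventually.of_forall fun y => habs _) ?_ ?_
    · filter_upwards [Ioo_mem_nhdsLT (show (0 : ℝ) < 1 / 4 by norm_num)] with y hy
      exact hleft y (Real.cos_pos_of_mem_Ioo ⟨by nlinarith [hy.1], by nlinarith [hy.2]⟩)
    · filter_upwards [Ioo_mem_nhdsGT (show (1 / 4 : ℝ) < 1 / 2 by norm_num)] with y hy
      exact hright y (Real.cos_neg_of_pi_div_two_lt_of_lt (by nlinarith [hy.1])
        (by nlinarith [hy.2]))
  have hall : (fun y : ℝ => σ (y : UnitAddCircle)) = 0 :=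
    AnalyticOnNhd.eq_of_eventuallyEq (fun y _ => hσan y) (fun y _ => analyticAt_const) hzero
  have h1 := re_apply_eq_integral_reDensity F S (fun l hl => (hFmem l hl).1) 1
  have h2 : ((ContinuousMap.mk _ Complex.continuous_ofReal).comp (1 : C(UnitAddCircle, ℝ)) :
      C(UnitAddCircle, ℂ)) = 1 := by ext; simp
  have h3 : ∀ x : UnitAddCircle, reDensity F S x = 0 := fun x => by
    induction x using QuotientAddGroup.induction_on with
    | H y => exact congrFun hall y
  rw [h2, hS1] at h1
  simp [h3] at h1

/-! ### Automata with postselection -/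

open scoped ComplexOrder

namespace QFAProgram

variable {𝕜 : Type*} [RCLike 𝕜] {α Q : Type} [Fintype Q] [DecidableEq Q]

/-- The superoperator of a tape symbol as a real-linear map. -/
noncomputable def superopLin (M : QFAProgram 𝕜 α Q) (σ : TapeSymbol α) :
    Matrix Q Q 𝕜 →ₗ[ℝ] Matrix Q Q 𝕜 where
  toFun := M.superop σ
  map_add' ρ ρ' := by simp [superop, Matrix.mul_add, Matrix.add_mul, Finset.sum_add_distrib]
  map_smul' a ρ := by simp [superop, Finset.smul_sum]

/-- The probability of an outcome as a real-linear functional of the state. -/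
noncomputable def outcomeLin (M : QFAProgram 𝕜 α Q) (τ : PostOutcome) :
    Matrix Q Q 𝕜 →ₗ[ℝ] ℝ where
  toFun ρ := RCLike.re (M.proj τ * ρ).trace
  map_add' ρ ρ' := by simp [Matrix.mul_add]
  map_smul' a ρ := by simp [Matrix.trace_smul, RCLike.smul_re]

theorem outcomeLin_apply (M : QFAProgram 𝕜 α Q) (τ : PostOutcome) (ρ : Matrix Q Q 𝕜) :
    M.outcomeLin τ ρ = ∑ q, if M.outcome q = τ then RCLike.re (ρ q q) else 0 := by
  simp only [outcomeLin, LinearMap.coe_mk, AddHom.coe_mk, proj, Matrix.trace, Matrix.diag_apply,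
    Matrix.diagonal_mul, map_sum]
  refine Finset.sum_congr rfl fun q _ => ?_
  split_ifs <;> simp

theorem posSemidef_superop (M : QFAProgram 𝕜 α Q) (σ : TapeSymbol α) {ρ : Matrix Q Q 𝕜}
    (hρ : ρ.PosSemidef) : (M.superop σ ρ).PosSemidef :=
  Matrix.posSemidef_sum _ fun _ _ => hρ.mul_mul_conjTranspose_same _

theorem trace_superop (M : QFAProgram 𝕜 α Q) (σ : TapeSymbol α) (ρ : Matrix Q Q 𝕜) :
    (M.superop σ ρ).trace = ρ.trace := by
  have h : ∀ i, (M.kraus σ i * ρ * (M.kraus σ i)ᴴ).trace =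
      ((M.kraus σ i)ᴴ * M.kraus σ i * ρ).trace := fun i => by
    rw [Matrix.trace_mul_comm, ← Matrix.mul_assoc]
  simp only [superop, Matrix.trace_sum, h]
  rw [← Matrix.trace_sum, ← Finset.sum_mul, M.kraus_complete, one_mul]

theorem posSemidef_finalState (M : QFAProgram 𝕜 α Q) (w : List α) :
    (M.finalState w).PosSemidef ∧ (M.finalState w).trace = 1 := by
  have h : ∀ (l : List (TapeSymbol α)) (ρ : Matrix Q Q 𝕜), ρ.PosSemidef ∧ ρ.trace = 1 →
      (l.foldl (fun ρ σ => M.superop σ ρ) ρ).PosSemidef ∧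
        (l.foldl (fun ρ σ => M.superop σ ρ) ρ).trace = 1 := by
    intro l
    induction l with
    | nil => exact fun ρ h => h
    | cons σ l ih =>
      exact fun ρ h => ih _ ⟨M.posSemidef_superop σ h.1, (M.trace_superop σ ρ).trans h.2⟩
  refine h _ _ ⟨?_, by simp⟩
  rw [← Matrix.diagonal_single]
  refine Matrix.PosSemidef.diagonal fun q => ?_
  rcases eq_or_ne q M.init with rfl | hq
  · simp
  · simp [hq]

theorem re_diag_finalState_nonneg (M : QFAProgram 𝕜 α Q) (w : List α) (q : Q) :
    0 ≤ RCLike.re (M.finalState w q q) :=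
  (RCLike.nonneg_iff.1 ((M.posSemidef_finalState w).1.diag_nonneg)).1

theorem outcomeProb_nonneg (M : QFAProgram 𝕜 α Q) (τ : PostOutcome) (w : List α) :
    0 ≤ M.outcomeProb τ w := by
  change 0 ≤ M.outcomeLin τ (M.finalState w)
  rw [outcomeLin_apply]
  refine Finset.sum_nonneg fun q _ => ?_
  split_ifs
  · exact M.re_diag_finalState_nonneg w q
  · exact le_rfl

theorem outcomeProb_pa_add_pr_le_one (M : QFAProgram 𝕜 α Q) (w : List α) :
    M.outcomeProb .pa w + M.outcomeProb .pr w ≤ 1 := by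
  change M.outcomeLin .pa (M.finalState w) + M.outcomeLin .pr (M.finalState w) ≤ 1
  have h := congrArg (RCLike.re (K := 𝕜)) (M.posSemidef_finalState w).2
  rw [Matrix.trace, map_sum, RCLike.one_re] at h
  rw [outcomeLin_apply, outcomeLin_apply, ← h, ← Finset.sum_add_distrib]
  refine Finset.sum_le_sum fun q _ => ?_
  have := M.re_diag_finalState_nonneg w q
  cases M.outcome q <;> simp [this]

theorem finalState_replicate (M : QFAProgram 𝕜 α Q) (a : α) (n : ℕ) :
    M.finalState (List.replicate n a) = M.superopLin .rightEnd
      ((M.superopLin (.letter a) ^ n) (M.superop .leftEnd (Matrix.single M.init M.init 1))) := by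
  have h : ∀ (n : ℕ) (ρ : Matrix Q Q 𝕜),
      (List.replicate n (TapeSymbol.letter a)).foldl (fun ρ σ => M.superop σ ρ) ρ =
        (M.superopLin (.letter a) ^ n) ρ := by
    intro n
    induction n with
    | zero => intro ρ; rfl
    | succ n ih => intro ρ; rw [List.replicate_succ, List.foldl_cons, ih, pow_succ]; rfl
  rw [finalState, tape, List.map_replicate, List.foldl_cons, List.foldl_append, h]
  rfl

end QFAProgram

/-- Cayley–Hamilton: the recurrence depends on `f` alone, so it is shared by all functionals `φ`, in
particular by both outcome probabilities. -/
theorem sum_charpoly_coeff_mul_pow_apply {E : Type*} [AddCommGroup E] [Module ℝ E]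
    [FiniteDimensional ℝ E] (f : E →ₗ[ℝ] E) (φ : E →ₗ[ℝ] ℝ) (v : E) (n : ℕ) :
    ∑ j ∈ Finset.range (f.charpoly.natDegree + 1), f.charpoly.coeff j * φ ((f ^ (n + j)) v) = 0 := by
  have h := f.aeval_self_charpoly
  rw [Polynomial.aeval_eq_sum_range] at h
  have h2 := congrArg (fun g : E →ₗ[ℝ] E => φ (g ((f ^ n) v))) h
  simp only [LinearMap.sum_apply, LinearMap.smul_apply, map_sum, map_smul, smul_eq_mul,
    LinearMap.zero_apply, map_zero] at h2
  rw [← h2]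
  refine Finset.sum_congr rfl fun j _ => ?_
  rw [add_comm n j, pow_add]
  rfl

namespace QFAP

variable {𝕜 : Type*} [RCLike 𝕜] {α Q : Type} [Fintype Q] [DecidableEq Q]

theorem le_sub_of_le_acceptProb (M : QFAP 𝕜 α Q) {w : List α} {ε : ℝ}
    (h : 1 - ε ≤ M.acceptProb w) :
    (1 - 2 * ε) * (M.outcomeProb .pa w + M.outcomeProb .pr w) ≤
      M.outcomeProb .pa w - M.outcomeProb .pr w := by
  rw [acceptProb, le_div_iff₀ (M.postselection_pos w)] at h
  linarith

theorem le_sub_of_le_rejectProb (M : QFAP 𝕜 α Q) {w : List α} {ε : ℝ}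
    (h : 1 - ε ≤ M.rejectProb w) :
    (1 - 2 * ε) * (M.outcomeProb .pa w + M.outcomeProb .pr w) ≤
      -(M.outcomeProb .pa w - M.outcomeProb .pr w) := by
  rw [rejectProb, le_div_iff₀ (M.postselection_pos w)] at h
  linarith

end QFAP

/-! ### The inclusion and the separating rotation language -/

/-- Every language recognized with bounded error by an automaton with postselection is
stochastic. -/
theorem postBQAL_subset_stochasticLanguages (𝕜 : Type*) [RCLike 𝕜] :
    PostBQAL 𝕜 ⊆ StochasticLanguages := by
  rintro L ⟨Q, _, _, M, ε, -, hε, hacc, hrej⟩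
  have : Nonempty Q := ⟨M.init⟩
  have : FiniteDimensional ℝ (Matrix Q Q 𝕜) := Module.Finite.trans 𝕜 _
  refine mem_stochasticLanguages_of_linear M.superopLin (Matrix.single M.init M.init 1)
    (M.outcomeLin .pa - M.outcomeLin .pr) fun w => ?_
  change _ ↔ 0 < M.outcomeProb .pa w - M.outcomeProb .pr w
  have hκ : 0 < (1 - 2 * ε) * (M.outcomeProb .pa w + M.outcomeProb .pr w) :=
    mul_pos (by linarith) (M.postselection_pos w)
  refine ⟨fun hw => hκ.trans_le (M.le_sub_of_le_acceptProb (hacc w hw)), fun h => ?_⟩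
  by_contra hw
  linarith [M.le_sub_of_le_rejectProb (hrej w hw)]

/-- The unary language of the lengths at which the rotation by `√2` has positive cosine. -/
noncomputable def rotationLanguage : FormalLanguage where
  alphabet := Unit
  finite_alphabet := inferInstance
  words := {w | 0 < Real.cos (2 * Real.pi * (w.length * √2))}

theorem rotationLanguage_mem_stochasticLanguages : rotationLanguage ∈ StochasticLanguages := by
  -- The automaton is the plane `ℂ` over `ℝ`: each letter multiplies by `z`, and the real part is
  -- the cosine.
  let z : ℂ := Complex.exp ((2 * Real.pi * √2 : ℝ) * Complex.I)
  let T : TapeSymbol Unit → ℂ →ₗ[ℝ] ℂ := fun σ =>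
    match σ with
    | .letter _ => LinearMap.mulLeft ℝ z
    | _ => LinearMap.id
  have h : ∀ (w : List Unit) (v : ℂ),
      (w.map TapeSymbol.letter).foldl (fun v σ => T σ v) v = z ^ w.length * v := by
    intro w
    induction w with
    | nil => intro v; simp
    | cons a w ih =>
      intro v
      rw [List.map_cons, List.foldl_cons, ih, List.length_cons, pow_succ, mul_assoc]
      rfl
  have h2 : ∀ w : List Unit, 0 < Real.cos (2 * Real.pi * (w.length * √2)) ↔
      0 < ((tape w).foldl (fun v σ => T σ v) 1).re := by
    intro w
    have h3 : (tape w).foldl (fun v σ => T σ v) 1 =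
        Complex.exp ((2 * Real.pi * (w.length * √2) : ℝ) * Complex.I) := by
      rw [tape, List.foldl_cons, List.foldl_append]
      refine ((h w 1).trans (mul_one _)).trans ?_
      rw [← Complex.exp_nat_mul]
      congr 1
      push_cast
      ring
    rw [h3, Complex.exp_ofReal_mul_I_re]
  exact mem_stochasticLanguages_of_linear (L := rotationLanguage) T 1 Complex.reLm h2

theorem rotationLanguage_notMem_postBQAL (𝕜 : Type*) [RCLike 𝕜] :
    rotationLanguage ∉ PostBQAL 𝕜 := by
  rintro ⟨Q, _, _, M, ε, -, hε, hacc, hrej⟩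
  have : FiniteDimensional ℝ (Matrix Q Q 𝕜) := Module.Finite.trans 𝕜 _
  let M' : QFAP 𝕜 Unit Q := M
  let p : PostOutcome → ℕ → ℝ := fun τ n => M'.outcomeProb τ (List.replicate n ())
  set f := M'.superopLin (.letter ())
  have hrec : ∀ τ n, ∑ j ∈ Finset.range (f.charpoly.natDegree + 1),
      f.charpoly.coeff j * p τ (n + j) = 0 := by
    intro τ n
    have h := sum_charpoly_coeff_mul_pow_apply f (M'.outcomeLin τ ∘ₗ M'.superopLin .rightEnd)
      (M'.superop .leftEnd (Matrix.single M'.init M'.init 1)) n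
    rw [← h]
    refine Finset.sum_congr rfl fun j _ => ?_
    rw [LinearMap.comp_apply, ← M'.finalState_replicate () (n + j)]
    rfl
  have hmem : ∀ n : ℕ, List.replicate n () ∈ rotationLanguage.words ↔
      0 < Real.cos (2 * Real.pi * (n * √2)) := by
    intro n
    change 0 < Real.cos (2 * Real.pi * ((List.replicate n ()).length * √2)) ↔ _
    rw [List.length_replicate]
  -- Sum and difference of the outcome probabilities turn error `ε` into the relative gap `κ = 1 -
  -- 2ε`, without dividing by the postselection probability.
  refine false_of_recurrence_of_cos_sign (s := fun n => p .pa n + p .pr n)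
    (t := fun n => p .pa n - p .pr n) (c := f.charpoly) (κ := 1 - 2 * ε)
    (fun n => M'.postselection_pos _) (fun n => M'.outcomeProb_pa_add_pr_le_one _) (fun n => ?_)
    f.charpoly_monic.ne_zero (fun n => ?_) (fun n => ?_) irrational_sqrt_two (by linarith)
    (fun n hn => M'.le_sub_of_le_acceptProb (hacc _ ((hmem n).2 hn)))
    (fun n hn => M'.le_sub_of_le_rejectProb (hrej _ fun h => absurd ((hmem n).1 h) (not_lt.2 hn)))
  · have h1 : 0 ≤ p .pa n := M'.outcomeProb_nonneg _ _
    have h2 : 0 ≤ p .pr n := M'.outcomeProb_nonneg _ _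
    rw [abs_le]
    constructor <;> linarith
  · simp only [mul_add, Finset.sum_add_distrib, hrec, add_zero]
  · simp only [mul_sub, Finset.sum_sub_distrib, hrec, sub_zero]

theorem mainTheorem8 (𝕜 : Type*) [RCLike 𝕜] : PostBQAL 𝕜 ⊂ StochasticLanguages := by
  refine ⟨postBQAL_subset_stochasticLanguages 𝕜, fun h => ?_⟩
  exact rotationLanguage_notMem_postBQAL 𝕜 (h rotationLanguage_mem_stochasticLanguages)
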